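/- Let $G$ be a Polish, locally compact, abelian topological group with Borel $\sigma$-algebra, and let $\lambda$ be a Haar measure on $G$. For a $G$-valued random variable $Z$ whose law has a density $f$ with respect to $\lambda$, let $$h(Z)=-\int_G f\log f\,d\lambda$$ be its entropy (with $0\log 0=0$); we say that $Z$ has finite entropy if its law has a density $f$ with respect to $\lambda$ and $f\log f$ is $\lambda$-integrable. For $G$-valued random variables $X,Y$, not necessarily defined on the same probability space, the Ruzsa divergence is $$d_R(X\|Y)=h(X'-Y')-h(X'),$$ where $X',Y'$ are independent random variables with the same laws as $X$ and $Y$, respectively. Theorem. Let $X,Y$ be $G$-valued random variables such that $X$, $Y$, $X'-Y'$ and $X'+Y'$ have finite entropy, where $X',Y'$ are independent with the same laws as $X$ and $Y$. Then $$d_R(X\|-Y)\le 2\,d_R(X\|Y)+d_R(Y\|X).$$ -/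

import Mathlib

open MeasureTheory

noncomputable section

/-- The density `dP/dm` of a law `P` on `G` with respect to a reference (Haar) measure `m`,
as a real-valued function. -/
def lawDensity {G : Type*} [MeasurableSpace G] (m P : Measure G) (x : G) : ℝ :=
  (P.rnDeriv m x).toReal

/-- The entropy `- ∫ f log f dm` of a law `P` with density `f` with respect to `m`
(with `0 log 0 = 0`). It is meaningful when `HasFiniteEntropy m P` holds. -/
def entropy {G : Type*} [MeasurableSpace G] (m P : Measure G) : ℝ :=
  ∫ x, Real.negMulLog (lawDensity m P x) ∂m

/-- The entropy of `P` with respect to `m` is well-defined and finite: `P` has a density `f`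
with respect to `m`, and `f log f` is Lebesgue integrable. -/
def HasFiniteEntropy {G : Type*} [MeasurableSpace G] (m P : Measure G) : Prop :=
  P ≪ m ∧ Integrable (fun x => Real.negMulLog (lawDensity m P x)) m

/-- The law of `X' - Y'`, where `X'` and `Y'` are independent with laws `P` and `Q`. -/
def differenceLaw {G : Type*} [MeasurableSpace G] [AddCommGroup G] (P Q : Measure G) :
    Measure G :=
  (P.prod Q).map (fun p => p.1 - p.2)

/-- The Ruzsa divergence `d_R(X‖Y) = h(X' - Y') - h(X')` of two random variables `X`, `Y`,
which may live on different probability spaces `(Ω, μ)` and `(Ω', ν)`. Here `X'` and `Y'` are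
independent with the laws of `X` and `Y`, and `h` is the entropy with respect to `m`. -/
def ruzsaDivergence {G Ω Ω' : Type*} [MeasurableSpace G] [AddCommGroup G]
    [MeasurableSpace Ω] [MeasurableSpace Ω'] (m : Measure G)
    (X : Ω → G) (μ : Measure Ω) (Y : Ω' → G) (ν : Measure Ω') : ℝ :=
  entropy m (differenceLaw (μ.map X) (ν.map Y)) - entropy m (μ.map X)

end

open scoped ENNReal

/-! ### Entropies of densities, log-densities and Gibbs' inequality. -/

section Entropy

variable {G : Type*} [MeasurableSpace G]

/-! Since `h(Y - X) = h(X - Y)`, the claim rearranges to `h(X + Y) + h(X) + h(Y) ≤ 3 h(X - Y)`. Let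
`f`, `g`, `D`, `S` be the densities of `X`, `Y`, `X - Y`, `X + Y`. Take `(x₁, y₁)` and `(x₂, y₂)`
conditionally independent given their common difference, and `(x₃, y₃)` an independent copy of `(X,
Y)`. Put `U = D(x₃ - y₂) D(x₁ - y₃) D(x₁ - y₁) / (f(x₁) g(y₂) S(x₃ + y₃))`. Each argument has the
law whose density is evaluated there, so `E log U` is the left side minus the right side
(`integral_log_density`). By Gibbs' inequality (`integral_log_toReal_nonpos`) it suffices that `E U
≤ 1`, which is `lintegral_sumDiffRatio_le`. The point is the identity `x₃ - y₂ = x₁ + x₃ - (x₂ +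
y₁)`: once densities cancel, `U` integrates as a product of two translates of `D`. Working with
densities avoids entropies of joint laws, so only the four assumed entropies need be finite. -/

theorem lawDensity_withDensity_ae (m : Measure G) [SigmaFinite m] {f : G → ℝ≥0∞}
    (hf : Measurable f) :
    ∀ᵐ x ∂m, lawDensity m (m.withDensity f) x = (f x).toReal := by
  filter_upwards [Measure.rnDeriv_withDensity m hf] with x hx
  simp [lawDensity, hx]

theorem entropy_withDensity (m : Measure G) [SigmaFinite m] {f : G → ℝ≥0∞}
    (hf : Measurable f) :
    entropy m (m.withDensity f) = ∫ x, Real.negMulLog (f x).toReal ∂m := by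
  refine integral_congr_ae ?_
  filter_upwards [lawDensity_withDensity_ae m hf] with x hx
  rw [hx]

theorem HasFiniteEntropy.integrable_withDensity {m : Measure G} [SigmaFinite m] {f : G → ℝ≥0∞}
    (hf : Measurable f) (h : HasFiniteEntropy m (m.withDensity f)) :
    Integrable (fun x => Real.negMulLog (f x).toReal) m := by
  refine h.2.congr ?_
  filter_upwards [lawDensity_withDensity_ae m hf] with x hx
  rw [hx]

theorem ae_lt_top_of_withDensity {m : Measure G} {f : G → ℝ≥0∞} (hf : Measurable f)
    [IsFiniteMeasure (m.withDensity f)] : ∀ᵐ x ∂m, f x < ∞ := by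
  refine ae_lt_top hf ?_
  have := measure_ne_top (m.withDensity f) Set.univ
  simpa using this

theorem ae_withDensity_toReal_ne_zero {m : Measure G} {f : G → ℝ≥0∞} (hf : Measurable f)
    [IsFiniteMeasure (m.withDensity f)] : ∀ᵐ x ∂(m.withDensity f), (f x).toReal ≠ 0 := by
  rw [ae_withDensity_iff hf]
  filter_upwards [ae_lt_top_of_withDensity hf] with x hx h0
  exact (ENNReal.toReal_pos h0 hx.ne).ne'

/-- A random variable `A` whose law has density `f` and finite entropy has an integrable
log-density. -/
theorem integrable_log_density {Ω : Type*} [MeasurableSpace Ω] {π : Measure Ω} {m : Measure G}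
    [SigmaFinite m] {f : G → ℝ≥0∞} (hf : Measurable f) [IsFiniteMeasure (m.withDensity f)]
    {A : Ω → G} (hA : MeasurePreserving A π (m.withDensity f))
    (h : HasFiniteEntropy m (m.withDensity f)) :
    Integrable (fun ω => Real.log (f (A ω)).toReal) π := by
  have key : Integrable (fun x => Real.log (f x).toReal) (m.withDensity f) := by
    rw [integrable_withDensity_iff hf (ae_lt_top_of_withDensity hf)]
    refine (h.integrable_withDensity hf).neg.congr (ae_of_all _ fun x => ?_)
    simp only [Pi.neg_apply, Real.negMulLog]
    ring
  exact hA.integrable_comp_of_integrable key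

theorem integral_log_density {Ω : Type*} [MeasurableSpace Ω] {π : Measure Ω} {m : Measure G}
    [SigmaFinite m] {f : G → ℝ≥0∞} (hf : Measurable f) [IsFiniteMeasure (m.withDensity f)]
    {A : Ω → G} (hA : MeasurePreserving A π (m.withDensity f)) :
    ∫ ω, Real.log (f (A ω)).toReal ∂π = -entropy m (m.withDensity f) := by
  have hlog : Measurable fun x => Real.log (f x).toReal := Real.measurable_log.comp hf.ennreal_toReal
  rw [← integral_map (φ := A) (f := fun x => Real.log (f x).toReal) hA.measurable.aemeasurable
      hlog.aestronglyMeasurable, hA.map_eq, entropy_withDensity m hf, ← integral_neg,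
    integral_withDensity_eq_integral_toReal_smul hf (ae_lt_top_of_withDensity hf)]
  refine integral_congr_ae (ae_of_all _ fun x => ?_)
  simp only [Real.negMulLog, smul_eq_mul]
  ring

theorem ae_density_comp_toReal_ne_zero {Ω : Type*} [MeasurableSpace Ω] {π : Measure Ω}
    {m : Measure G} {f : G → ℝ≥0∞} (hf : Measurable f) [IsFiniteMeasure (m.withDensity f)]
    {A : Ω → G} (hA : MeasurePreserving A π (m.withDensity f)) :
    ∀ᵐ ω ∂π, (f (A ω)).toReal ≠ 0 :=
  hA.quasiMeasurePreserving.ae (ae_withDensity_toReal_ne_zero hf)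

/-- Gibbs' inequality. -/
theorem integral_log_toReal_nonpos {Ω : Type*} [MeasurableSpace Ω] {π : Measure Ω}
    [IsProbabilityMeasure π] {U : Ω → ℝ≥0∞} (hU : Measurable U) (h1 : ∫⁻ ω, U ω ∂π ≤ 1)
    (h0 : ∀ᵐ ω ∂π, (U ω).toReal ≠ 0) (hint : Integrable (fun ω => Real.log (U ω).toReal) π) :
    ∫ ω, Real.log (U ω).toReal ∂π ≤ 0 := by
  have htop : ∫⁻ ω, U ω ∂π ≠ ∞ := (h1.trans_lt ENNReal.one_lt_top).ne
  have hUi : Integrable (fun ω => (U ω).toReal) π :=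
    integrable_toReal_of_lintegral_ne_top hU.aemeasurable htop
  have hle : ∫ ω, Real.log (U ω).toReal ∂π ≤ ∫ ω, ((U ω).toReal - 1) ∂π := by
    refine integral_mono_ae hint (hUi.sub (integrable_const _)) ?_
    filter_upwards [h0] with ω hω
    exact Real.log_le_sub_one_of_pos (lt_of_le_of_ne ENNReal.toReal_nonneg hω.symm)
  have hval : ∫ ω, (U ω).toReal ∂π ≤ 1 := by
    rw [integral_toReal hU.aemeasurable (ae_lt_top hU htop)]
    exact ENNReal.toReal_le_of_le_ofReal zero_le_one (by simpa using h1)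
  rw [integral_sub hUi (integrable_const _)] at hle
  simp at hle
  linarith

end Entropy

/-! ### Densities of sums and differences, and reflection. -/

section Convolution

variable {G : Type*} [MeasurableSpace G] [AddCommGroup G] [MeasurableAdd₂ G] [MeasurableNeg G]

/-- The density of `X - Y` for independent `X ∼ P` and `Y` with density `g`. -/
noncomputable def subDensity (P : Measure G) (g : G → ℝ≥0∞) (d : G) : ℝ≥0∞ :=
  ∫⁻ x, g (x - d) ∂P

/-- The density of `X + Y` for independent `X ∼ P` and `Y` with density `g`. -/
noncomputable def addDensity (P : Measure G) (g : G → ℝ≥0∞) (s : G) : ℝ≥0∞ :=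
  ∫⁻ x, g (s - x) ∂P

theorem measurable_subDensity (P : Measure G) [SFinite P] {g : G → ℝ≥0∞} (hg : Measurable g) :
    Measurable (subDensity P g) :=
  Measurable.lintegral_prod_right' (f := fun p : G × G => g (p.2 - p.1)) (by fun_prop)

theorem measurable_addDensity (P : Measure G) [SFinite P] {g : G → ℝ≥0∞} (hg : Measurable g) :
    Measurable (addDensity P g) :=
  Measurable.lintegral_prod_right' (f := fun p : G × G => g (p.1 - p.2)) (by fun_prop)

variable (m : Measure G) [SFinite m] [m.IsAddLeftInvariant]

theorem differenceLaw_withDensity [m.IsNegInvariant] (P : Measure G) [SFinite P] {g : G → ℝ≥0∞}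
    (hg : Measurable g) :
    differenceLaw P (m.withDensity g) = m.withDensity (subDensity P g) := by
  refine Measure.ext_of_lintegral _ fun h hh => ?_
  have h1 := measurable_subDensity P hg
  rw [differenceLaw, lintegral_map hh (by fun_prop), lintegral_prod _ (by fun_prop),
    lintegral_withDensity_eq_lintegral_mul _ h1 hh]
  calc ∫⁻ x, ∫⁻ y, h (x - y) ∂m.withDensity g ∂P
      = ∫⁻ x, ∫⁻ d, g (x - d) * h d ∂m ∂P := by
        refine lintegral_congr fun x => ?_
        rw [lintegral_withDensity_eq_lintegral_mul _ hg (by fun_prop),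
          ← lintegral_sub_left_eq_self _ x]
        simp
    _ = ∫⁻ d, ∫⁻ x, g (x - d) * h d ∂P ∂m := lintegral_lintegral_swap (by fun_prop)
    _ = _ := by
        refine lintegral_congr fun d => ?_
        rw [lintegral_mul_const _ (by fun_prop)]
        rfl

theorem map_add_prod_withDensity (P : Measure G) [SFinite P] {g : G → ℝ≥0∞}
    (hg : Measurable g) :
    (P.prod (m.withDensity g)).map (fun p => p.1 + p.2) = m.withDensity (addDensity P g) := by
  refine Measure.ext_of_lintegral _ fun h hh => ?_
  have h1 := measurable_addDensity P hg
  rw [lintegral_map hh (by fun_prop), lintegral_prod _ (by fun_prop),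
    lintegral_withDensity_eq_lintegral_mul _ h1 hh]
  calc ∫⁻ x, ∫⁻ y, h (x + y) ∂m.withDensity g ∂P
      = ∫⁻ x, ∫⁻ s, g (s - x) * h s ∂m ∂P := by
        refine lintegral_congr fun x => ?_
        rw [lintegral_withDensity_eq_lintegral_mul _ hg (by fun_prop),
          ← lintegral_add_left_eq_self (fun s => g (s - x) * h s) x]
        simp
    _ = ∫⁻ s, ∫⁻ x, g (s - x) * h s ∂P ∂m := lintegral_lintegral_swap (by fun_prop)
    _ = _ := by
        refine lintegral_congr fun d => ?_
        rw [lintegral_mul_const _ (by fun_prop)]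
        rfl

theorem differenceLaw_map_neg (P Q : Measure G) [SFinite P] [SFinite Q] :
    differenceLaw P (Q.map (fun y => -y)) = (P.prod Q).map (fun p => p.1 + p.2) := by
  have h := Measure.map_prod_map P Q (measurable_id (α := G)) (measurable_neg (G := G))
  rw [Measure.map_id] at h
  change differenceLaw P (Q.map Neg.neg) = _
  rw [differenceLaw, h, Measure.map_map (by fun_prop) (by fun_prop)]
  congr 1
  ext p
  simp

theorem differenceLaw_swap (P Q : Measure G) [SFinite P] [SFinite Q] :
    differenceLaw Q P = (differenceLaw P Q).map (fun x => -x) := by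
  rw [differenceLaw, differenceLaw, ← Measure.prod_swap, Measure.map_map (by fun_prop)
    measurable_swap, Measure.map_map (by fun_prop) (by fun_prop)]
  congr 1
  ext p
  simp

omit [MeasurableAdd₂ G] [SFinite m] [m.IsAddLeftInvariant] in
theorem entropy_map_neg [SigmaFinite m] [m.IsNegInvariant] {f : G → ℝ≥0∞} (hf : Measurable f) :
    entropy m ((m.withDensity f).map (fun x => -x)) = entropy m (m.withDensity f) := by
  have h : (m.withDensity f).map (fun x => -x) = m.withDensity (fun x => f (-x)) := by
    refine Measure.ext_of_lintegral _ fun h hh => ?_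
    rw [lintegral_map hh (by fun_prop), lintegral_withDensity_eq_lintegral_mul _ hf (by fun_prop),
      lintegral_withDensity_eq_lintegral_mul _ (by fun_prop) hh, ← lintegral_neg_eq_self]
    simp
  rw [h, entropy_withDensity m (by fun_prop), entropy_withDensity m hf]
  exact integral_neg_eq_self (fun x => Real.negMulLog (f x).toReal) m

end Convolution

/-! ### The coupling along the fibres of the difference, and its marginals. -/

section Coupling

variable {G : Type*} [MeasurableSpace G] [AddCommGroup G] [MeasurableAdd₂ G] [MeasurableNeg G]

/-- The law of `(x₁, y₁, x₂)`, where `(x₁, y₁)` and `(x₂, y₂)` are copies of `(X, Y)` that are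
conditionally independent given the common difference `x₁ - y₁ = x₂ - y₂`. -/
noncomputable def fiberCoupling (P Q : Measure G) (g : G → ℝ≥0∞) : Measure (G × G × G) :=
  (P.prod (Q.prod P)).withDensity fun w =>
    g (w.2.2 - (w.1 - w.2.1)) * (subDensity P g (w.1 - w.2.1))⁻¹

variable (m : Measure G) [SigmaFinite m] [m.IsAddLeftInvariant] [m.IsNegInvariant]
  (P : Measure G) [IsProbabilityMeasure P] {g : G → ℝ≥0∞} (hg : Measurable g)
  [IsProbabilityMeasure (m.withDensity g)]

include hg

theorem isProbabilityMeasure_subDensity :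
    IsProbabilityMeasure (m.withDensity (subDensity P g)) := by
  rw [← differenceLaw_withDensity m P hg]
  exact Measure.isProbabilityMeasure_map (by fun_prop)

omit [m.IsNegInvariant] in
theorem isProbabilityMeasure_addDensity :
    IsProbabilityMeasure (m.withDensity (addDensity P g)) := by
  rw [← map_add_prod_withDensity m P hg]
  exact Measure.isProbabilityMeasure_map (by fun_prop)

omit [IsProbabilityMeasure (m.withDensity g)] in
theorem measurePreserving_sub :
    MeasurePreserving (fun p : G × G => p.1 - p.2) (P.prod (m.withDensity g))
      (m.withDensity (subDensity P g)) :=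
  ⟨by fun_prop, differenceLaw_withDensity m P hg⟩

omit [m.IsNegInvariant] [IsProbabilityMeasure (m.withDensity g)] in
theorem measurePreserving_add_prod :
    MeasurePreserving (fun p : G × G => p.1 + p.2) (P.prod (m.withDensity g))
      (m.withDensity (addDensity P g)) :=
  ⟨by fun_prop, map_add_prod_withDensity m P hg⟩

omit [m.IsAddLeftInvariant] [m.IsNegInvariant]
  [IsProbabilityMeasure (m.withDensity g)] in
theorem lintegral_fiberCoupling {h : G × G × G → ℝ≥0∞} (hh : Measurable h) :
    ∫⁻ w, h w ∂fiberCoupling P (m.withDensity g) g =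
      ∫⁻ p, ∫⁻ x₂, g (x₂ - (p.1 - p.2)) * (subDensity P g (p.1 - p.2))⁻¹ * h (p.1, p.2, x₂) ∂P
        ∂(P.prod (m.withDensity g)) := by
  have h1 := measurable_subDensity P hg
  rw [fiberCoupling, lintegral_withDensity_eq_lintegral_mul _ (by fun_prop) hh,
    lintegral_prod _ (by fun_prop), lintegral_prod _ (by
      refine Measurable.aemeasurable (Measurable.lintegral_prod_right'
        (f := fun q : (G × G) × G => g (q.2 - (q.1.1 - q.1.2)) *
          (subDensity P g (q.1.1 - q.1.2))⁻¹ * h (q.1.1, q.1.2, q.2)) (by fun_prop)))]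
  refine lintegral_congr fun x₁ => ?_
  rw [lintegral_prod _ (by fun_prop)]
  rfl

/-- Integrating out `x₂` turns the coupling density into `D * D⁻¹` at `x₁ - y₁`, which is `1`
because `D` is almost surely neither `0` nor `∞` there. -/
theorem measurePreserving_fiberCoupling_fst :
    MeasurePreserving (fun w : G × G × G => (w.1, w.2.1)) (fiberCoupling P (m.withDensity g) g)
      (P.prod (m.withDensity g)) := by
  have h1 := measurable_subDensity P hg
  refine ⟨by fun_prop, Measure.ext_of_lintegral _ fun h hh => ?_⟩
  have := isProbabilityMeasure_subDensity m P hg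
  rw [lintegral_map hh (by fun_prop), lintegral_fiberCoupling m P hg (by fun_prop)]
  refine lintegral_congr_ae ?_
  have hne := ae_density_comp_toReal_ne_zero h1 (measurePreserving_sub m P hg)
  filter_upwards [hne] with p hp
  rw [ENNReal.toReal_ne_zero] at hp
  rw [lintegral_mul_const _ (by fun_prop), lintegral_mul_const _ (by fun_prop)]
  change subDensity P g _ * _ * _ = _
  rw [ENNReal.mul_inv_cancel hp.1 hp.2, one_mul]

theorem isProbabilityMeasure_fiberCoupling :
    IsProbabilityMeasure (fiberCoupling P (m.withDensity g) g) := by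
  have h := measurePreserving_fiberCoupling_fst m P hg
  exact ⟨by rw [← Set.preimage_univ, h.measure_preimage MeasurableSet.univ.nullMeasurableSet,
    measure_univ]⟩

/-- The map is `y₂`. Conditionally on `d = x₁ - y₁`, the weight `g (x₂ - d) / D d` makes `x₂ - d`
distributed as `Y` given `X - Y = d`; averaging over `d` returns the law of `Y`. -/
theorem measurePreserving_fiberCoupling_snd :
    MeasurePreserving (fun w : G × G × G => w.2.2 - (w.1 - w.2.1))
      (fiberCoupling P (m.withDensity g) g) (m.withDensity g) := by
  have h1 := measurable_subDensity P hg
  have := isProbabilityMeasure_fiberCoupling m P hg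
  refine ⟨by fun_prop, ?_⟩
  have : IsProbabilityMeasure ((fiberCoupling P (m.withDensity g) g).map
    (fun w : G × G × G => w.2.2 - (w.1 - w.2.1))) :=
      Measure.isProbabilityMeasure_map (by fun_prop)
  -- Comparing two probability measures, one inequality suffices, so `u * u⁻¹ ≤ 1` can be used
  -- without treating the values `0` and `∞` separately.
  refine Measure.eq_of_le_of_isProbabilityMeasure (Measure.le_iff.2 fun s hs => ?_)
  set h : G → ℝ≥0∞ := s.indicator 1 with h_def
  have hh : Measurable h := measurable_one.indicator hs
  have hφ : Measurable fun d => ∫⁻ x, g (x - d) * (subDensity P g d)⁻¹ * h (x - d) ∂P :=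
    Measurable.lintegral_prod_right' (f := fun q : G × G =>
      g (q.2 - q.1) * (subDensity P g q.1)⁻¹ * h (q.2 - q.1)) (by fun_prop)
  rw [← lintegral_indicator_one hs, ← lintegral_indicator_one hs, ← h_def,
    lintegral_map hh (by fun_prop), lintegral_fiberCoupling m P hg (by fun_prop)]
  calc _ = ∫⁻ d, ∫⁻ x, g (x - d) * (subDensity P g d)⁻¹ * h (x - d) ∂P
            ∂(m.withDensity (subDensity P g)) :=
          (measurePreserving_sub m P hg).lintegral_comp hφ
    _ = ∫⁻ d, ∫⁻ x, subDensity P g d * (g (x - d) * (subDensity P g d)⁻¹ * h (x - d)) ∂P ∂m := by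
        rw [lintegral_withDensity_eq_lintegral_mul _ h1 hφ]
        refine lintegral_congr fun d => ?_
        rw [lintegral_const_mul _ (by fun_prop)]
        rfl
    _ ≤ ∫⁻ d, ∫⁻ x, g (x - d) * h (x - d) ∂P ∂m := by
        refine lintegral_mono fun d => lintegral_mono fun x => ?_
        calc _ = subDensity P g d * (subDensity P g d)⁻¹ * (g (x - d) * h (x - d)) := by ring
          _ ≤ 1 * (g (x - d) * h (x - d)) := by gcongr; exact ENNReal.mul_inv_le_one _
          _ = _ := one_mul _
    _ = ∫⁻ x, ∫⁻ d, g (x - d) * h (x - d) ∂m ∂P := lintegral_lintegral_swap (by fun_prop)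
    _ = ∫⁻ x, ∫⁻ y, g y * h y ∂m ∂P := by
        refine lintegral_congr fun x => ?_
        exact lintegral_sub_left_eq_self (fun y => g y * h y) x
    _ = _ := by
        rw [lintegral_const, measure_univ, mul_one,
          lintegral_withDensity_eq_lintegral_mul _ hg hh]
        rfl

end Coupling

/-! ### The likelihood ratio has mean at most one; the entropy inequality. -/

section SumDifference

variable {G : Type*} [MeasurableSpace G] [AddCommGroup G] [MeasurableAdd₂ G] [MeasurableNeg G]

/-- The likelihood ratio whose expected logarithm is `h(X) + h(Y) + h(X + Y) - 3 h(X - Y)`. -/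
noncomputable def sumDiffRatio (P : Measure G) (f g : G → ℝ≥0∞) (q : (G × G × G) × (G × G)) :
    ℝ≥0∞ :=
  subDensity P g (q.2.1 - (q.1.2.2 - (q.1.1 - q.1.2.1))) * subDensity P g (q.1.1 - q.2.2) *
    subDensity P g (q.1.1 - q.1.2.1) * (f q.1.1)⁻¹ * (g (q.1.2.2 - (q.1.1 - q.1.2.1)))⁻¹ *
    (addDensity P g (q.2.1 + q.2.2))⁻¹

theorem measurable_sumDiffRatio (P : Measure G) [SFinite P] {f g : G → ℝ≥0∞} (hf : Measurable f)
    (hg : Measurable g) : Measurable (sumDiffRatio P f g) := by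
  have h1 := measurable_subDensity P hg
  have h2 := measurable_addDensity P hg
  unfold sumDiffRatio
  fun_prop

variable (m : Measure G) [SigmaFinite m] [m.IsAddLeftInvariant] [m.IsNegInvariant]
  {f g : G → ℝ≥0∞} (hf : Measurable f) (hg : Measurable g)
  [IsProbabilityMeasure (m.withDensity f)] [IsProbabilityMeasure (m.withDensity g)]

include hf hg

/-- What remains of `E U` for fixed `c = x₂ + y₁`. The factor `(f x₁)⁻¹` turns the law of `x₁` into
Haar measure, which permits the substitution `a = x₁ + x₃`, `s = x₃ + y₃`, with `x₁ - y₃ = a - s`.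
Then `x₃` occurs only in `g (s - x₃)`, whose integral `S s` cancels `(S s)⁻¹`. -/
theorem lintegral_sub_add_kernel_le (c : G) :
    ∫⁻ x₁, ∫⁻ x₃, ∫⁻ y₃, subDensity (m.withDensity f) g (x₁ + x₃ - c) *
      subDensity (m.withDensity f) g (x₁ - y₃) * (f x₁)⁻¹ *
      (addDensity (m.withDensity f) g (x₃ + y₃))⁻¹ ∂m.withDensity g ∂m.withDensity f
      ∂m.withDensity f ≤ 1 := by
  set P := m.withDensity f with hP
  have h1 := measurable_subDensity P hg
  have h2 := measurable_addDensity P hg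
  set D := subDensity P g
  set S := addDensity P g with hS
  have hD1 : ∫⁻ d, D d ∂m = 1 := by
    have := (isProbabilityMeasure_subDensity m P hg).measure_univ
    simpa using this
  have hmeas : Measurable fun x₁ => ∫⁻ x₃, ∫⁻ y₃, D (x₁ + x₃ - c) * D (x₁ - y₃) * (f x₁)⁻¹ *
      (S (x₃ + y₃))⁻¹ ∂m.withDensity g ∂P := by
    refine Measurable.lintegral_prod_right' (f := fun q : G × G => ∫⁻ y₃, D (q.1 + q.2 - c) *
      D (q.1 - y₃) * (f q.1)⁻¹ * (S (q.2 + y₃))⁻¹ ∂m.withDensity g) ?_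
    exact Measurable.lintegral_prod_right' (f := fun q : (G × G) × G => D (q.1.1 + q.1.2 - c) *
      D (q.1.1 - q.2) * (f q.1.1)⁻¹ * (S (q.1.2 + q.2))⁻¹) (by fun_prop)
  have hk : Measurable fun q : G × G => ∫⁻ s, g (s - q.2) * (D (q.1 - c) * D (q.1 - s) * (S s)⁻¹) ∂m :=
    Measurable.lintegral_prod_right' (f := fun q : (G × G) × G => g (q.2 - q.1.2) *
      (D (q.1.1 - c) * D (q.1.1 - q.2) * (S q.2)⁻¹)) (by fun_prop)
  have hk' : Measurable fun q : G × G =>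
      ∫⁻ s, g (s - q.2) * (D (q.1 + q.2 - c) * D (q.1 + q.2 - s) * (S s)⁻¹) ∂m :=
    Measurable.lintegral_prod_right' (f := fun q : (G × G) × G => g (q.2 - q.1.2) *
      (D (q.1.1 + q.1.2 - c) * D (q.1.1 + q.1.2 - q.2) * (S q.2)⁻¹)) (by fun_prop)
  calc _ = ∫⁻ x₁, f x₁ * ∫⁻ x₃, ∫⁻ y₃, D (x₁ + x₃ - c) * D (x₁ - y₃) * (f x₁)⁻¹ *
        (S (x₃ + y₃))⁻¹ ∂m.withDensity g ∂P ∂m := by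
        rw [hP, lintegral_withDensity_eq_lintegral_mul _ hf hmeas]
        rfl
    _ ≤ ∫⁻ x₁, ∫⁻ x₃, ∫⁻ s, g (s - x₃) * (D (x₁ + x₃ - c) * D (x₁ + x₃ - s) * (S s)⁻¹) ∂m
          ∂P ∂m := by
        refine lintegral_mono fun x₁ => ?_
        have hm : Measurable fun x₃ => ∫⁻ y₃, D (x₁ + x₃ - c) * D (x₁ - y₃) * (f x₁)⁻¹ *
            (S (x₃ + y₃))⁻¹ ∂m.withDensity g :=
          Measurable.lintegral_prod_right' (f := fun q : G × G => D (x₁ + q.1 - c) *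
            D (x₁ - q.2) * (f x₁)⁻¹ * (S (q.1 + q.2))⁻¹) (by fun_prop)
        dsimp only
        rw [← lintegral_const_mul _ hm]
        refine lintegral_mono fun x₃ => ?_
        dsimp only
        rw [← lintegral_const_mul _ (by fun_prop),
          lintegral_withDensity_eq_lintegral_mul _ hg (by fun_prop),
          ← lintegral_add_left_eq_self (fun s => g (s - x₃) * _) x₃]
        refine lintegral_mono fun y => ?_
        simp only [Pi.mul_apply, add_sub_cancel_left]
        rw [show x₁ + x₃ - (x₃ + y) = x₁ - y by abel]
        calc _ = f x₁ * (f x₁)⁻¹ * (g y * (D (x₁ + x₃ - c) * D (x₁ - y) * (S (x₃ + y))⁻¹)) := by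
              ring
          _ ≤ 1 * (g y * (D (x₁ + x₃ - c) * D (x₁ - y) * (S (x₃ + y))⁻¹)) := by
              gcongr; exact ENNReal.mul_inv_le_one _
          _ = _ := one_mul _
    _ = ∫⁻ x₃, ∫⁻ x₁, ∫⁻ s, g (s - x₃) * (D (x₁ + x₃ - c) * D (x₁ + x₃ - s) * (S s)⁻¹) ∂m
          ∂m ∂P := lintegral_lintegral_swap hk'.aemeasurable
    -- Invariance of `m` under translation by `x₃`, with `a = x₁ + x₃`.
    _ = ∫⁻ x₃, ∫⁻ a, ∫⁻ s, g (s - x₃) * (D (a - c) * D (a - s) * (S s)⁻¹) ∂m ∂m ∂P := by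
        refine lintegral_congr fun x₃ => ?_
        exact lintegral_add_right_eq_self
          (fun a => ∫⁻ s, g (s - x₃) * (D (a - c) * D (a - s) * (S s)⁻¹) ∂m) x₃
    _ = ∫⁻ a, ∫⁻ x₃, ∫⁻ s, g (s - x₃) * (D (a - c) * D (a - s) * (S s)⁻¹) ∂m ∂P ∂m :=
        (lintegral_lintegral_swap hk.aemeasurable).symm
    _ = ∫⁻ a, ∫⁻ s, S s * (D (a - c) * D (a - s) * (S s)⁻¹) ∂m ∂m := by
        refine lintegral_congr fun a => ?_
        rw [lintegral_lintegral_swap (by fun_prop)]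
        refine lintegral_congr fun s => ?_
        rw [lintegral_mul_const _ (by fun_prop)]
        rfl
    _ ≤ ∫⁻ a, ∫⁻ s, D (a - c) * D (a - s) ∂m ∂m := by
        refine lintegral_mono fun a => lintegral_mono fun s => ?_
        calc _ = S s * (S s)⁻¹ * (D (a - c) * D (a - s)) := by ring
          _ ≤ 1 * (D (a - c) * D (a - s)) := by gcongr; exact ENNReal.mul_inv_le_one _
          _ = _ := one_mul _
    _ = 1 := by
        have hinner : ∀ a, ∫⁻ s, D (a - c) * D (a - s) ∂m = D (a - c) := fun a => by
          rw [lintegral_const_mul _ (by fun_prop), lintegral_sub_left_eq_self D, hD1, mul_one]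
        simp_rw [hinner]
        rw [lintegral_sub_right_eq_self D, hD1]

theorem lintegral_sumDiffRatio_le :
    ∫⁻ q, sumDiffRatio (m.withDensity f) f g q ∂((fiberCoupling (m.withDensity f)
      (m.withDensity g) g).prod ((m.withDensity f).prod (m.withDensity g))) ≤ 1 := by
  have hU := measurable_sumDiffRatio (m.withDensity f) hf hg
  set P := m.withDensity f with hP
  have h1 := measurable_subDensity P hg
  have h2 := measurable_addDensity P hg
  have := isProbabilityMeasure_fiberCoupling m P hg
  set D := subDensity P g with hD
  set S := addDensity P g with hS
  have hW : Measurable fun w => ∫⁻ r, sumDiffRatio P f g (w, r) ∂(P.prod (m.withDensity g)) :=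
    hU.lintegral_prod_right'
  have hk : Measurable fun w : G × G × G =>
      g (w.2.2 - (w.1 - w.2.1)) * (subDensity P g (w.1 - w.2.1))⁻¹ := by
    rw [← hD]
    fun_prop
  -- The pair `z = (y₁, x₂)` is integrated last: the kernel bound applies for each `z`, with `c = x₂
  -- + y₁`.
  rw [lintegral_prod _ hU.aemeasurable, fiberCoupling,
    lintegral_withDensity_eq_lintegral_mul _ hk hW,
    lintegral_prod_symm _ (hk.mul hW).aemeasurable]
  calc _ ≤ ∫⁻ _ : G × G, 1 ∂((m.withDensity g).prod P) := by
        refine lintegral_mono fun z => le_trans (lintegral_mono fun x₁ => ?_)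
          (lintegral_sub_add_kernel_le m hf hg (z.2 + z.1))
        simp only [Pi.mul_apply]
        have hV : Measurable fun r : G × G => sumDiffRatio P f g ((x₁, z), r) := by fun_prop
        have hV' : Measurable fun x₃ => ∫⁻ y₃, sumDiffRatio P f g ((x₁, z), x₃, y₃)
            ∂m.withDensity g := hV.lintegral_prod_right'
        rw [lintegral_prod _ hV.aemeasurable, ← lintegral_const_mul _ hV']
        refine lintegral_mono fun x₃ => ?_
        dsimp only
        rw [← lintegral_const_mul _ (by fun_prop)]
        refine lintegral_mono fun y₃ => ?_
        simp only [sumDiffRatio, ← hP, ← hD, ← hS]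
        rw [show x₁ + x₃ - (z.2 + z.1) = x₃ - (z.2 - (x₁ - z.1)) by abel]
        set y₂ := z.2 - (x₁ - z.1)
        set d := x₁ - z.1
        calc _ = g y₂ * (g y₂)⁻¹ * (D d * (D d)⁻¹) *
              (D (x₃ - y₂) * D (x₁ - y₃) * (f x₁)⁻¹ * (S (x₃ + y₃))⁻¹) := by ring
          _ ≤ 1 * 1 * (D (x₃ - y₂) * D (x₁ - y₃) * (f x₁)⁻¹ * (S (x₃ + y₃))⁻¹) := by
              gcongr <;> exact ENNReal.mul_inv_le_one _
          _ = _ := by rw [one_mul, one_mul]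
    _ = 1 := by simp

/-- The sum-difference inequality for entropies, in terms of densities. -/
theorem entropy_add_le_three_mul_entropy_sub
    (hX : HasFiniteEntropy m (m.withDensity f)) (hY : HasFiniteEntropy m (m.withDensity g))
    (hsub : HasFiniteEntropy m (m.withDensity (subDensity (m.withDensity f) g)))
    (hadd : HasFiniteEntropy m (m.withDensity (addDensity (m.withDensity f) g))) :
    entropy m (m.withDensity (addDensity (m.withDensity f) g)) + entropy m (m.withDensity f) +
      entropy m (m.withDensity g) ≤
      3 * entropy m (m.withDensity (subDensity (m.withDensity f) g)) := by
  have hU := measurable_sumDiffRatio (m.withDensity f) hf hg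
  have hU1 := lintegral_sumDiffRatio_le m hf hg
  set P := m.withDensity f with hP
  set Q := m.withDensity g with hQ
  have h1 := measurable_subDensity P hg
  have h2 := measurable_addDensity P hg
  have i1 := isProbabilityMeasure_fiberCoupling m P hg
  have i2 := isProbabilityMeasure_subDensity m P hg
  have i3 := isProbabilityMeasure_addDensity m P hg
  set R := fiberCoupling P Q g
  have hfst : MeasurePreserving Prod.fst (R.prod (P.prod Q)) R := measurePreserving_fst
  have hsnd : MeasurePreserving Prod.snd (R.prod (P.prod Q)) (P.prod Q) := measurePreserving_snd
  have hpair : MeasurePreserving (fun w : G × G × G => (w.1, w.2.1)) R (P.prod Q) :=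
    measurePreserving_fiberCoupling_fst m P hg
  have hx : MeasurePreserving (fun w : G × G × G => w.1) R P :=
    (measurePreserving_fst (μ := P) (ν := Q)).comp hpair
  have hy : MeasurePreserving (fun w : G × G × G => w.2.2 - (w.1 - w.2.1)) R Q :=
    measurePreserving_fiberCoupling_snd m P hg
  have hdiff := measurePreserving_sub m P hg
  -- `x₃` is independent of `y₂`, and in `mB` `x₁` is independent of `y₃`, so both differences have
  -- the law of `X - Y`.
  have mA : MeasurePreserving (fun q : (G × G × G) × (G × G) =>
      q.2.1 - (q.1.2.2 - (q.1.1 - q.1.2.1))) (R.prod (P.prod Q)) (m.withDensity (subDensity P g)) :=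
    hdiff.comp (Measure.measurePreserving_swap.comp
      (hy.prod (measurePreserving_fst (μ := P) (ν := Q))))
  have mB : MeasurePreserving (fun q : (G × G × G) × (G × G) => q.1.1 - q.2.2)
      (R.prod (P.prod Q)) (m.withDensity (subDensity P g)) :=
    hdiff.comp (hx.prod (measurePreserving_snd (μ := P) (ν := Q)))
  have mC : MeasurePreserving (fun q : (G × G × G) × (G × G) => q.1.1 - q.1.2.1)
      (R.prod (P.prod Q)) (m.withDensity (subDensity P g)) := hdiff.comp (hpair.comp hfst)
  have mX : MeasurePreserving (fun q : (G × G × G) × (G × G) => q.1.1)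
      (R.prod (P.prod Q)) (m.withDensity f) := hx.comp hfst
  have mY : MeasurePreserving (fun q : (G × G × G) × (G × G) => q.1.2.2 - (q.1.1 - q.1.2.1))
      (R.prod (P.prod Q)) (m.withDensity g) := hy.comp hfst
  have mS : MeasurePreserving (fun q : (G × G × G) × (G × G) => q.2.1 + q.2.2)
      (R.prod (P.prod Q)) (m.withDensity (addDensity P g)) :=
    (measurePreserving_add_prod m P hg).comp hsnd
  have nA := ae_density_comp_toReal_ne_zero h1 mA
  have nB := ae_density_comp_toReal_ne_zero h1 mB
  have nC := ae_density_comp_toReal_ne_zero h1 mC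
  have nX := ae_density_comp_toReal_ne_zero hf mX
  have nY := ae_density_comp_toReal_ne_zero hg mY
  have nS := ae_density_comp_toReal_ne_zero h2 mS
  have jA := integrable_log_density h1 mA hsub
  have jB := integrable_log_density h1 mB hsub
  have jC := integrable_log_density h1 mC hsub
  have jX := integrable_log_density hf mX hX
  have jY := integrable_log_density hg mY hY
  have jS := integrable_log_density h2 mS hadd
  have hne : ∀ᵐ q ∂(R.prod (P.prod Q)), (sumDiffRatio P f g q).toReal ≠ 0 := by
    filter_upwards [nA, nB, nC, nX, nY, nS] with q hA hB hC hX hY hS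
    simp only [sumDiffRatio, ENNReal.toReal_mul, ENNReal.toReal_inv]
    exact mul_ne_zero (mul_ne_zero (mul_ne_zero (mul_ne_zero (mul_ne_zero hA hB) hC)
      (inv_ne_zero hX)) (inv_ne_zero hY)) (inv_ne_zero hS)
  have hlog : (fun q => Real.log (sumDiffRatio P f g q).toReal) =ᵐ[R.prod (P.prod Q)]
      ((((((fun q => Real.log (subDensity P g
        (q.2.1 - (q.1.2.2 - (q.1.1 - q.1.2.1)))).toReal) +
      fun q => Real.log (subDensity P g (q.1.1 - q.2.2)).toReal) +
      fun q => Real.log (subDensity P g (q.1.1 - q.1.2.1)).toReal) -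
      fun q => Real.log (f q.1.1).toReal) -
      fun q => Real.log (g (q.1.2.2 - (q.1.1 - q.1.2.1))).toReal) -
      fun q => Real.log (addDensity P g (q.2.1 + q.2.2)).toReal) := by
    filter_upwards [nA, nB, nC, nX, nY, nS] with q hA hB hC hX hY hS
    simp only [sumDiffRatio, ENNReal.toReal_mul, ENNReal.toReal_inv, Pi.sub_apply, Pi.add_apply]
    rw [Real.log_mul (mul_ne_zero (mul_ne_zero (mul_ne_zero (mul_ne_zero hA hB) hC)
        (inv_ne_zero hX)) (inv_ne_zero hY)) (inv_ne_zero hS),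
      Real.log_mul (mul_ne_zero (mul_ne_zero (mul_ne_zero hA hB) hC)
        (inv_ne_zero hX)) (inv_ne_zero hY),
      Real.log_mul (mul_ne_zero (mul_ne_zero hA hB) hC) (inv_ne_zero hX),
      Real.log_mul (mul_ne_zero hA hB) hC, Real.log_mul hA hB, Real.log_inv, Real.log_inv,
      Real.log_inv]
    ring
  have hint := ((((jA.add jB).add jC).sub jX).sub jY).sub jS
  have hfinal := integral_log_toReal_nonpos hU hU1 hne (hint.congr hlog.symm)
  rw [integral_congr_ae hlog, integral_sub' ((((jA.add jB).add jC).sub jX).sub jY) jS,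
    integral_sub' (((jA.add jB).add jC).sub jX) jY, integral_sub' ((jA.add jB).add jC) jX,
    integral_add' (jA.add jB) jC, integral_add' jA jB,
    integral_log_density h1 mA, integral_log_density h1 mB, integral_log_density h1 mC,
    integral_log_density hf mX, integral_log_density hg mY, integral_log_density h2 mS] at hfinal
  linarith

end SumDifference

/-! ### From laws on a Polish group to densities. -/

theorem theorem4p2 {G Ω Ω' : Type*}
    [AddCommGroup G] [TopologicalSpace G] [IsTopologicalAddGroup G]
    [PolishSpace G] [LocallyCompactSpace G] [MeasurableSpace G] [BorelSpace G]
    (m : Measure G) [m.IsAddHaarMeasure]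
    [MeasurableSpace Ω] (μ : Measure Ω) [IsProbabilityMeasure μ]
    [MeasurableSpace Ω'] (ν : Measure Ω') [IsProbabilityMeasure ν]
    (X : Ω → G) (hX : Measurable X) (Y : Ω' → G) (hY : Measurable Y)
    (hhX : HasFiniteEntropy m (μ.map X))
    (hhY : HasFiniteEntropy m (ν.map Y))
    (hhsub : HasFiniteEntropy m (differenceLaw (μ.map X) (ν.map Y)))
    (hhadd : HasFiniteEntropy m (differenceLaw (μ.map X) (ν.map (fun ω => -Y ω)))) :
    ruzsaDivergence m X μ (fun ω => -Y ω) ν ≤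
      2 * ruzsaDivergence m X μ Y ν + ruzsaDivergence m Y ν X μ := by
  -- Regularity makes the Haar measure of an abelian group invariant under negation.
  have : m.Regular := by
    let := TopologicalSpace.upgradeIsCompletelyMetrizable G
    infer_instance
  have hneg : ν.map (fun ω => -Y ω) = (ν.map Y).map (fun y => -y) :=
    (Measure.map_map measurable_neg hY).symm
  have : IsProbabilityMeasure (μ.map X) := Measure.isProbabilityMeasure_map hX.aemeasurable
  have : IsProbabilityMeasure (ν.map Y) := Measure.isProbabilityMeasure_map hY.aemeasurable
  unfold ruzsaDivergence
  rw [hneg] at hhadd ⊢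
  rw [differenceLaw_map_neg] at hhadd ⊢
  rw [differenceLaw_swap (μ.map X) (ν.map Y)]
  obtain ⟨f, hf, hPf⟩ : ∃ f, Measurable f ∧ m.withDensity f = μ.map X :=
    ⟨_, Measure.measurable_rnDeriv _ _, Measure.withDensity_rnDeriv_eq _ _ hhX.1⟩
  obtain ⟨g, hg, hQg⟩ : ∃ g, Measurable g ∧ m.withDensity g = ν.map Y :=
    ⟨_, Measure.measurable_rnDeriv _ _, Measure.withDensity_rnDeriv_eq _ _ hhY.1⟩
  generalize μ.map X = P at *
  generalize ν.map Y = Q at *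
  subst hPf hQg
  rw [map_add_prod_withDensity m _ hg] at hhadd ⊢
  rw [differenceLaw_withDensity m _ hg] at hhsub ⊢
  rw [entropy_map_neg m (measurable_subDensity _ hg)]
  linarith [entropy_add_le_three_mul_entropy_sub m hf hg hhX hhY hhsub hhadd]
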